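/- Let $f:\mathbb R^n\to\mathbb R^n$ and $g:\mathbb R^n\to\mathbb R^{n\times m}$ be locally Lipschitz, and let $\mathcal U=\{u\in\mathbb R^m: A_u u\le b_u\}$ be a compact polytope with nonempty interior, where $A_u\in\mathbb R^{p\times m}$, $b_u\in\mathbb R^p$. Write $L_fh(x)=\frac{\partial h}{\partial x}(x)f(x)$ and $L_gh(x)=\frac{\partial h}{\partial x}(x)g(x)$. Let $h:\mathbb R^n\to\mathbb R$ be a strict control barrier function for $S=\{x: h(x)\le 0\}$, that is, $h$ is continuously differentiable and $$\inf_{u\in\mathcal U}\,[L_fh(x)+L_gh(x)u]<0\qquad\text{for all }x\in\partial S .$$ Let $\alpha:(-b,a)\to\mathbb R$, $0<a,b\le\infty$, be an extended class-$\mathcal K$ function (continuous, strictly increasing, $\alpha(0)=0$) whose domain contains all values of $h$, and put $$K(x)=\{u\in\mathbb R^m:\ L_gh(x)u\le-\alpha(h(x))-L_fh(x),\ A_uu\le b_u\}.$$ For $\gamma>0$ let $K_\gamma(x)=\{u\in K(x): d(u,\mathbb R^m\setminus K(x))\ge\gamma\}$ (with $d(u,\emptyset)=\infty$), which is the set of all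 $u$ with $u+\gamma B\subseteq\operatorname{int}K(x)$ for the open unit ball $B$, and let $$G_\gamma(x)=\{f(x)+g(x)u:\ u\in K_\gamma(x)\}.$$ Let $\Omega\subseteq\mathbb R^n$ be any set and $0<\tau\le\infty$. Let $x:[0,\tau)\to\mathbb R^n$ be a trajectory of $\dot x(t)\in G_\gamma(x(t))$, i.e. $x$ is absolutely continuous on compact subintervals and satisfies the inclusion for almost every $t\in[0,\tau)$, under a Lebesgue measurable control $u:[0,\tau)\to\mathbb R^m$, i.e. $u(t)\in\mathcal U$ and $\dot x(t)=f(x(t))+g(x(t))u(t)$ for almost every $t\in[0,\tau)$. Suppose $x(0)\in\operatorname{int}(S\cap\Omega)$, and let $[0,T)\subseteq[0,\tau)$ be the maximal interval such that $x(t)\in\operatorname{int}(\Omega)$ for all $t\in[0,T)$. Then $x(t)\in S$ for all $t\in[0,T)$. -/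

import Mathlib

open MeasureTheory Set

namespace StrictCBF

noncomputable section

/-- The Euclidean space `ℝᵏ`. -/
abbrev E (k : ℕ) : Type := EuclideanSpace ℝ (Fin k)

/-- The polytope `{u ∈ ℝᵐ : A u ≤ b}` (componentwise inequality). -/
def polytope {p m : ℕ} (A : Matrix (Fin p) (Fin m) ℝ) (b : Fin p → ℝ) : Set (E m) :=
  {u | ∀ i, A.mulVec u.ofLp i ≤ b i}

/-- The Lie derivative `L_f h (x) = (∂h/∂x)(x) f(x)` along the vector field `f`. -/
def lieF {n : ℕ} (h : E n → ℝ) (f : E n → E n) (x : E n) : ℝ :=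
  fderiv ℝ h x (f x)

/-- The row vector `L_g h (x) = (∂h/∂x)(x) g(x)`, as the linear form `u ↦ L_g h (x) u` on `ℝᵐ`. -/
def lieG {n m : ℕ} (h : E n → ℝ) (g : E n → Matrix (Fin n) (Fin m) ℝ) (x : E n) :
    E m →ₗ[ℝ] ℝ :=
  (fderiv ℝ h x).toLinearMap ∘ₗ (g x).toEuclideanLin

/-- The right-hand side `f(x) + g(x) u` of the control-affine system. -/
def field {n m : ℕ} (f : E n → E n) (g : E n → Matrix (Fin n) (Fin m) ℝ) (x : E n) (u : E m) :
    E n :=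
  f x + (g x).toEuclideanLin u

/-- The set `S = {x : h x ≤ 0}`. -/
def safeSet {n : ℕ} (h : E n → ℝ) : Set (E n) := {x | h x ≤ 0}

/-- `h` is a strict control barrier function for `S = {h ≤ 0}`: it is `C¹` and
`inf_{u ∈ U} [L_f h (x) + L_g h (x) u] < 0` at every boundary point `x` of `S`. -/
def IsStrictCBF {n m : ℕ} (f : E n → E n) (g : E n → Matrix (Fin n) (Fin m) ℝ)
    (U : Set (E m)) (h : E n → ℝ) : Prop :=
  ContDiff ℝ 1 h ∧
    ∀ x ∈ frontier (safeSet h), sInf ((fun u => lieF h f x + lieG h g x u) '' U) < 0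

/-- The open interval `(-b, a)` with possibly infinite endpoints. -/
def openInterval (b a : EReal) : Set ℝ := {r | -b < (r : EReal) ∧ (r : EReal) < a}

/-- `α : (-b, a) → ℝ` is an extended class `𝒦` function (`0 < a, b ≤ ∞`). The values of `α`
outside `(-b, a)` are irrelevant. -/
def IsExtendedClassK (b a : EReal) (α : ℝ → ℝ) : Prop :=
  0 < b ∧ 0 < a ∧ ContinuousOn α (openInterval b a) ∧ StrictMonoOn α (openInterval b a) ∧ α 0 = 0

/-- The polytope `K(x)` of safe inputs: `A_S(x) u ≤ b_S(x)` and `A u ≤ b`, where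
`A_S(x) = L_g h (x)` and `b_S(x) = -α(h(x)) - L_f h (x)`. -/
def K {n m p : ℕ} (f : E n → E n) (g : E n → Matrix (Fin n) (Fin m) ℝ)
    (A : Matrix (Fin p) (Fin m) ℝ) (b : Fin p → ℝ) (h : E n → ℝ) (α : ℝ → ℝ) (x : E n) :
    Set (E m) :=
  {u | lieG h g x u ≤ -α (h x) - lieF h f x} ∩ polytope A b

/-- The `γ`-contraction `{u ∈ C : d(u, Cᶜ) ≥ γ}` of a set `C` (the distance to the empty set
being `∞`). -/
def contraction {m : ℕ} (γ : ℝ) (C : Set (E m)) : Set (E m) :=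
  {u | u ∈ C ∧ ENNReal.ofReal γ ≤ Metric.infEDist u Cᶜ}

/-- For `γ > 0` the contraction is the Minkowski difference `int C - γ B(0,1)`, with `B(0,1)` the
open unit ball: the set of all `u` with `u + γ B(0,1) ⊆ int C`. -/
theorem mem_contraction_iff {m : ℕ} {γ : ℝ} (hγ : 0 < γ) (C : Set (E m)) (u : E m) :
    u ∈ contraction γ C ↔ ∀ w ∈ Metric.ball (0 : E m) 1, u + γ • w ∈ interior C := by
  have hball : (∀ w ∈ Metric.ball (0 : E m) 1, u + γ • w ∈ interior C) ↔
      Metric.ball u γ ⊆ C := by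
    rw [← Metric.isOpen_ball.subset_interior_iff]
    constructor
    · intro H v hv
      have := H (γ⁻¹ • (v - u)) (by
        rw [mem_ball_zero_iff, norm_smul, norm_inv, Real.norm_of_nonneg hγ.le,
          inv_mul_lt_iff₀ hγ, mul_one, ← dist_eq_norm]
        exact hv)
      simpa [smul_smul, hγ.ne'] using this
    · intro H w hw
      apply H
      rw [mem_ball_zero_iff] at hw
      rw [Metric.mem_ball, dist_eq_norm, add_sub_cancel_left, norm_smul,
        Real.norm_of_nonneg hγ.le]
      nlinarith
  rw [hball]
  constructor
  · rintro ⟨-, hd⟩ v hv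
    by_contra hvC
    have h1 : ENNReal.ofReal γ ≤ edist u v := hd.trans (Metric.infEDist_le_edist_of_mem hvC)
    rw [edist_dist, ENNReal.ofReal_le_ofReal_iff dist_nonneg, dist_comm] at h1
    exact absurd hv (by simpa using h1)
  · intro H
    refine ⟨H (Metric.mem_ball_self hγ), Metric.le_infEDist.2 fun v hv => ?_⟩
    rw [edist_dist]
    apply ENNReal.ofReal_le_ofReal
    by_contra hlt
    exact hv (H (by rw [Metric.mem_ball, dist_comm]; exact not_le.1 hlt))

/-- The `γ`-contraction `K_γ(x)` of the safe input set `K(x)`. -/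
def Kγ {n m p : ℕ} (f : E n → E n) (g : E n → Matrix (Fin n) (Fin m) ℝ)
    (A : Matrix (Fin p) (Fin m) ℝ) (b : Fin p → ℝ) (h : E n → ℝ) (α : ℝ → ℝ) (γ : ℝ) (x : E n) :
    Set (E m) :=
  contraction γ (K f g A b h α x)

/-- The set of velocities `G_γ(x) = {f(x) + g(x) u : u ∈ K_γ(x)}`. -/
def Gγ {n m p : ℕ} (f : E n → E n) (g : E n → Matrix (Fin n) (Fin m) ℝ)
    (A : Matrix (Fin p) (Fin m) ℝ) (b : Fin p → ℝ) (h : E n → ℝ) (α : ℝ → ℝ) (γ : ℝ) (x : E n) :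
    Set (E n) :=
  {v | ∃ u ∈ Kγ f g A b h α γ x, v = field f g x u}

/-- The time interval `[0, τ)`, with `τ` possibly infinite. -/
def timeInterval (τ : EReal) : Set ℝ := {t | 0 ≤ t ∧ (t : EReal) < τ}

/-- `x` is a trajectory of the differential inclusion `ẋ ∈ F(x)` on `[0, τ)`: it is absolutely
continuous on every compact subinterval and satisfies the inclusion almost everywhere. -/
def IsTrajectory {n : ℕ} (F : E n → Set (E n)) (τ : EReal) (x : ℝ → E n) : Prop :=
  (∀ s ∈ timeInterval τ, AbsolutelyContinuousOnInterval x 0 s) ∧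
    ∀ᵐ t : ℝ, t ∈ timeInterval τ → ∃ v ∈ F (x t), HasDerivAt x v t

/-- `u` is a Lebesgue measurable control on `[0, τ)`, with values in `U` almost everywhere, that
generates `x`: `ẋ(t) = f(x(t)) + g(x(t)) u(t)` for almost every `t ∈ [0, τ)`. (Being almost
everywhere measurable is the same as being Lebesgue measurable, for values in `ℝᵐ`.) -/
def IsGeneratedBy {n m : ℕ} (f : E n → E n) (g : E n → Matrix (Fin n) (Fin m) ℝ)
    (U : Set (E m)) (τ : EReal) (x : ℝ → E n) (u : ℝ → E m) : Prop :=
  AEMeasurable u (volume.restrict (timeInterval τ)) ∧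
    ∀ᵐ t : ℝ, t ∈ timeInterval τ → u t ∈ U ∧ HasDerivAt x (field f g (x t) (u t)) t

/-- The right endpoint `T` of the maximal interval `[0, T) ⊆ [0, τ)` on which `x(t) ∈ int Ω`. -/
def exitTime {n : ℕ} (Ω : Set (E n)) (τ : EReal) (x : ℝ → E n) : EReal :=
  sSup {T | T ≤ τ ∧ ∀ t ∈ timeInterval T, x t ∈ interior Ω}

/-- The supremum that defines the exit time is attained. -/
theorem isGreatest_exitTime {n : ℕ} (Ω : Set (E n)) (τ : EReal) (x : ℝ → E n) :
    IsGreatest {T | T ≤ τ ∧ ∀ t ∈ timeInterval T, x t ∈ interior Ω} (exitTime Ω τ x) := by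
  refine ⟨⟨sSup_le fun T hT => hT.1, ?_⟩, fun T hT => le_sSup hT⟩
  rintro t ⟨ht0, ht⟩
  obtain ⟨T, hT, htT⟩ := lt_sSup_iff.1 ht
  exact hT.2 t ⟨ht0, htT⟩

end

end StrictCBF

/-!
Along the trajectory, `φ(t) = h(x(t))` is absolutely continuous on compact intervals, since `h` is
locally Lipschitz. By the chain rule and the first inequality that defines `K(x)`, for almost
every `t`
`φ'(t) = L_f h (x(t)) + L_g h (x(t)) u ≤ -α(φ(t))` for some `u ∈ K_γ(x(t)) ⊆ K(x(t))`,
and `-α(φ(t)) < 0` where `φ(t) > 0`. An absolutely continuous function that starts at a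
nonpositive value and has a nonpositive derivative almost everywhere on `{φ > 0}` stays nonpositive
(`AbsolutelyContinuousOnInterval.nonpos_of_deriv_nonpos_of_pos`): after its last zero before a time
at which it is positive, it would have to increase.

The conclusion holds in fact on all of `[0, τ)`, which contains `[0, T)`.
-/

open MeasureTheory Set

/-- A function that is Lipschitz on the range of an absolutely continuous curve preserves absolute
continuity. -/
theorem LipschitzOnWith.comp_absolutelyContinuousOnInterval {X Y : Type*} [PseudoMetricSpace X]
    [PseudoMetricSpace Y] {C : NNReal} {h : X → Y} {x : ℝ → X} {a b : ℝ}
    (hh : LipschitzOnWith C h (x '' uIcc a b)) (hx : AbsolutelyContinuousOnInterval x a b) :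
    AbsolutelyContinuousOnInterval (h ∘ x) a b := by
  rw [absolutelyContinuousOnInterval_iff] at hx ⊢
  intro ε hε
  have hC : (0 : ℝ) < C + 1 := by positivity
  obtain ⟨δ, hδ, H⟩ := hx (ε / (C + 1)) (by positivity)
  refine ⟨δ, hδ, fun I hI hlen => ?_⟩
  have hI' := hI.1
  calc ∑ i ∈ Finset.range I.1, dist ((h ∘ x) (I.2 i).1) ((h ∘ x) (I.2 i).2)
      ≤ ∑ i ∈ Finset.range I.1, (C + 1) * dist (x (I.2 i).1) (x (I.2 i).2) := by
        refine Finset.sum_le_sum fun i hi => ?_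
        refine (hh.dist_le_mul _ (mem_image_of_mem x (hI' i hi).1) _
          (mem_image_of_mem x (hI' i hi).2)).trans ?_
        gcongr
        linarith
    _ = (C + 1) * ∑ i ∈ Finset.range I.1, dist (x (I.2 i).1) (x (I.2 i).2) :=
        (Finset.mul_sum ..).symm
    _ < (C + 1) * (ε / (C + 1)) := mul_lt_mul_of_pos_left (H I hI hlen) hC
    _ = ε := by field_simp

/-- A locally Lipschitz function preserves absolute continuity on compact intervals. -/
theorem LocallyLipschitz.comp_absolutelyContinuousOnInterval {X Y : Type*}
    [SeminormedAddCommGroup X] [PseudoMetricSpace Y] {h : X → Y} {x : ℝ → X} {a b : ℝ}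
    (hh : LocallyLipschitz h) (hx : AbsolutelyContinuousOnInterval x a b) :
    AbsolutelyContinuousOnInterval (h ∘ x) a b := by
  obtain ⟨C, hC⟩ := (hh.locallyLipschitzOn (s := x '' uIcc a b)).exists_lipschitzOnWith_of_compact
    (isCompact_uIcc.image_of_continuousOn hx.continuousOn)
  exact hC.comp_absolutelyContinuousOnInterval hx

/-- Comparison principle: an absolutely continuous function with `φ a ≤ 0` whose derivative is
nonpositive at almost every point where `φ` is positive stays nonpositive. -/
theorem AbsolutelyContinuousOnInterval.nonpos_of_deriv_nonpos_of_pos {φ : ℝ → ℝ} {a b : ℝ}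
    (hab : a ≤ b) (hφ : AbsolutelyContinuousOnInterval φ a b) (ha : φ a ≤ 0)
    (hd : ∀ᵐ t, t ∈ Icc a b → 0 < φ t → deriv φ t ≤ 0) : φ b ≤ 0 := by
  by_contra! hb
  have hc : ContinuousOn φ (Icc a b) := by simpa [uIcc_of_le hab] using hφ.continuousOn
  -- The last time `s` at which `φ` is nonpositive.
  obtain ⟨s, ⟨hs, hs0 : φ s ≤ 0⟩, hmax⟩ :
      ∃ s, IsGreatest (Icc a b ∩ φ ⁻¹' Iic 0) s :=
    (isCompact_Icc.of_isClosed_subset (hc.preimage_isClosed_of_isClosed isClosed_Icc isClosed_Iic)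
      inter_subset_left).exists_isGreatest ⟨a, left_mem_Icc.2 hab, ha⟩
  have hpos : ∀ t ∈ Ioc s b, 0 < φ t := fun t ht => by
    by_contra! h0
    exact ht.1.not_ge (hmax ⟨⟨hs.1.trans ht.1.le, ht.2⟩, h0⟩)
  have hint : ∫ t in s..b, deriv φ t = φ b - φ s :=
    (hφ.mono (by rw [uIcc_of_le hab, uIcc_of_le hs.2]; exact Icc_subset_Icc_left hs.1)
      ).integral_deriv_eq_sub
  have hle : ∫ t in s..b, deriv φ t ≤ 0 := by
    rw [intervalIntegral.integral_of_le hs.2]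
    refine setIntegral_nonpos_of_ae_restrict ?_
    filter_upwards [ae_restrict_of_ae hd, ae_restrict_mem measurableSet_Ioc] with t ht hts
    exact ht ⟨hs.1.trans hts.1.le, hts.2⟩ (hpos t hts)
  linarith

namespace StrictCBF

theorem fderiv_field {n m : ℕ} (f : E n → E n) (g : E n → Matrix (Fin n) (Fin m) ℝ)
    (h : E n → ℝ) (x : E n) (u : E m) :
    fderiv ℝ h x (field f g x u) = lieF h f x + lieG h g x u :=
  map_add ..

theorem IsExtendedClassK.pos {b a : EReal} {α : ℝ → ℝ} (hα : IsExtendedClassK b a α) {r : ℝ}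
    (hr : r ∈ openInterval b a) (h0 : 0 < r) : 0 < α r := by
  obtain ⟨hb, ha, -, hmono, hα0⟩ := hα
  have hmem : (0 : ℝ) ∈ openInterval b a :=
    ⟨by simpa [EReal.neg_lt_comm] using hb, by simpa using ha⟩
  simpa [hα0] using hmono hmem hr h0

/-- No velocity in `G_γ(x)` increases `h` to first order at points `x` outside the safe set. -/
theorem fderiv_nonpos_of_mem_Gγ {n m p : ℕ} {f : E n → E n}
    {g : E n → Matrix (Fin n) (Fin m) ℝ} {A : Matrix (Fin p) (Fin m) ℝ} {b : Fin p → ℝ}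
    {h : E n → ℝ} {b₀ a₀ : EReal} {α : ℝ → ℝ} (hα : IsExtendedClassK b₀ a₀ α) {γ : ℝ} {x v : E n}
    (hx : h x ∈ openInterval b₀ a₀) (hpos : 0 < h x) (hv : v ∈ Gγ f g A b h α γ x) :
    fderiv ℝ h x v ≤ 0 := by
  obtain ⟨u, hu, rfl⟩ := hv
  have hu' : lieG h g x u ≤ -α (h x) - lieF h f x := hu.1.1
  rw [fderiv_field]
  linarith [hα.pos hx hpos]

end StrictCBF

theorem mainTheorem8 {n m p : ℕ}
    (f : StrictCBF.E n → StrictCBF.E n)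
    (g : StrictCBF.E n → Matrix (Fin n) (Fin m) ℝ)
    (hf : LocallyLipschitz f)
    (hg : ∀ i j, LocallyLipschitz fun x => g x i j)
    (A : Matrix (Fin p) (Fin m) ℝ) (b : Fin p → ℝ)
    (hUcompact : IsCompact (StrictCBF.polytope A b))
    (hUinterior : (interior (StrictCBF.polytope A b)).Nonempty)
    (h : StrictCBF.E n → ℝ)
    (hh : StrictCBF.IsStrictCBF f g (StrictCBF.polytope A b) h)
    (b₀ a₀ : EReal) (α : ℝ → ℝ)
    (hα : StrictCBF.IsExtendedClassK b₀ a₀ α)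
    (hαh : ∀ x, h x ∈ StrictCBF.openInterval b₀ a₀)
    (γ : ℝ) (hγ : 0 < γ)
    (Ω : Set (StrictCBF.E n))
    (τ : EReal) (hτ : 0 < τ)
    (x : ℝ → StrictCBF.E n) (u : ℝ → StrictCBF.E m)
    (hx : StrictCBF.IsTrajectory (StrictCBF.Gγ f g A b h α γ) τ x)
    (hu : StrictCBF.IsGeneratedBy f g (StrictCBF.polytope A b) τ x u)
    (hx0 : x 0 ∈ interior (StrictCBF.safeSet h ∩ Ω)) :
    ∀ t ∈ StrictCBF.timeInterval (StrictCBF.exitTime Ω τ x), x t ∈ StrictCBF.safeSet h := by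
  intro t ht
  have htτ : t ∈ StrictCBF.timeInterval τ :=
    ⟨ht.1, ht.2.trans_le (StrictCBF.isGreatest_exitTime Ω τ x).1.1⟩
  refine AbsolutelyContinuousOnInterval.nonpos_of_deriv_nonpos_of_pos (φ := h ∘ x) ht.1
    (hh.1.locallyLipschitz.comp_absolutelyContinuousOnInterval (hx.1 t htτ))
    (interior_subset hx0).1 ?_
  filter_upwards [hx.2] with s hs hst hpos
  obtain ⟨v, hv, hderiv⟩ := hs ⟨hst.1, (EReal.coe_le_coe_iff.2 hst.2).trans_lt htτ.2⟩
  have hdiff : HasFDerivAt h (fderiv ℝ h (x s)) (x s) :=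
    (hh.1.differentiable one_ne_zero (x s)).hasFDerivAt
  rw [(hdiff.comp_hasDerivAt s hderiv).deriv]
  exact StrictCBF.fderiv_nonpos_of_mem_Gγ hα (hαh (x s)) hpos hv
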